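/- Fix a finite set $P$ of binary node features. A graph $G=(V,E,\mathrm{lab})$ is a finite undirected loopless graph with labels $\mathrm{lab}(v)\subseteq P$; a pointed graph $(G,v)$ is a graph with a chosen node. A node classifier is an isomorphism-invariant map from pointed graphs to $\{0,1\}$. For a set $C$ of node classifiers, $\rho(C)$ is the set of pairs of pointed graphs on which every classifier in $C$ takes equal values. **HE-GNNs.** A $(D,D')$-GNN is a sequence of $L\ge 1$ layers $(\mathrm{agg}_i,\mathrm{com}_i)$ with arbitrary functions $\mathrm{agg}_i$ from finite multisets over $\mathbb{R}^{D_i}$ to $\mathbb{R}^{D_i}$ and $\mathrm{com}_i:\mathbb{R}^{2D_i}\to\mathbb{R}^{D_{i+1}}$, where $D_1=D$, $D_{L+1}=D'$ and $D_{i+1}\ge 1$; it updates an embedding $\mathrm{emb}:V\to\mathbb{R}^{D}$ by $\mathrm{emb}^{i}(v)=\mathrm{com}_i\big(\mathrm{emb}^{i-1}(v)\oplus\mathrm{agg}_i\{\!\{\mathrm{emb}^{i-1}(u) : (v,u)\in E\}\!\}\big)$, starting with $\mathrm{emb}^0=\mathrm{emb}$, and outputs $\mathrm{emb}^L$. A $(D,D')$-HE-GNN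 of nesting depth $0$ is a $(D,D')$-GNN; one of depth $d>0$ is a pair $(\mathcal B,\mathcal C)$ of a $(D+1,D'')$-HE-GNN $\mathcal B$ of depth $d-1$ and a $(D+D'',D')$-GNN $\mathcal C$, and it returns the result of running $\mathcal C$ on $v\mapsto \mathrm{emb}(v)\oplus \mathrm{run}_{\mathcal B}\big(G,\,u\mapsto \mathrm{emb}(u)\oplus\delta_{uv}\big)(v)$. An HE-GNN with $D=|P|$ and $D'=1$, run on the multi-hot encoding of the labels, classifies $(G,v)$ as $1$ iff its output at $v$ is positive. HE-GNN-$d$ is the set of all classifiers obtained with nesting depth $d$. **$k$-WL** ($k\ge 1$). The atomic type $\mathrm{atp}(\bar v)$ of a tuple of nodes records which entries are equal, which are adjacent, and the labels of the entries. Write $\bar v[w/j]$ for $\bar v$ with its $j$-th entry replaced by $w$. Colour $\bar v\in V^k$ by $c^0(\bar v)=\mathrm{atp}(\bar v)$ and $$c^{n+1}(\bar v)=\Big(c^n(\bar v),\ \{\!\{\big(\mathrm{atp}(\bar v w),\,c^n(\bar v[w/1]),\dots,c^n(\bar v[w/k])\big) : w\in V\}\!\}\Big).$$ Its classifiers are those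 that map $(G,v)$ to $1$ iff $c^n(v,\dots,v)\in S$, for a number of rounds $n\ge 0$ and a set $S$ of colours. **$k$-GNNs** ($k\ge 2$). A $k$-GNN is a sequence of $L\ge1$ layers, each with arbitrary aggregation functions $\mathrm{agg}_1,\dots,\mathrm{agg}_k$ from finite multisets over $\mathbb{R}^{D}$ to $\mathbb{R}^{D}$ and an arbitrary combination function $\mathrm{com}:\mathbb{R}^{(k+1)D}\to\mathbb{R}^{E}$, $E\ge 1$ (with $D,E$ depending on the layer). A layer updates an embedding $f:V^k\to\mathbb{R}^D$ to $$f'(\bar v)=\mathrm{com}\Big(f(\bar v)\oplus\bigoplus_{j=1}^{k}\mathrm{agg}_j\{\!\{f(\bar v[w/j]) : w\in V\}\!\}\Big).$$ The input is the one-hot encoding of the atomic types of the $k$-tuples, the output has dimension $1$, and $(G,v)$ is classified as $1$ iff the output at $(v,\dots,v)$ is positive. **Theorem.** For every finite $P$ and every $d\ge 0$, $$\rho\big((d+1)\text{-WL}\big)=\rho\big((d+2)\text{-GNN}\big)\subseteq\rho\big(\text{HE-GNN-}d\big).$$ -/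

import Mathlib

noncomputable section

/-! ## Graphs, pointed graphs and node classifiers -/

/-- A finite undirected graph without loops whose nodes carry binary features from `P`. -/
structure LabeledGraph (P : Type*) where
  V : Type
  [fintypeV : Fintype V]
  graph : SimpleGraph V
  lab : V → Set P

attribute [instance] LabeledGraph.fintypeV

/-- A graph together with one of its nodes. -/
structure PointedGraph (P : Type*) extends LabeledGraph P where
  pt : V

/-- `f` is an isomorphism of labelled graphs. -/
def IsGraphIso {P : Type*} {G H : LabeledGraph P} (f : G.V ≃ H.V) : Prop :=
  (∀ u w, H.graph.Adj (f u) (f w) ↔ G.graph.Adj u w) ∧ ∀ u, H.lab (f u) = G.lab u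

/-- Two pointed graphs are isomorphic. -/
def PointedIso {P : Type*} (A B : PointedGraph P) : Prop :=
  ∃ f : A.V ≃ B.V, IsGraphIso (G := A.toLabeledGraph) (H := B.toLabeledGraph) f ∧ f A.pt = B.pt

/-- A node classifier: an isomorphism invariant `{0,1}`-valued function on pointed graphs. -/
structure NodeClassifier (P : Type*) where
  toFun : PointedGraph P → Bool
  invariant : ∀ A B, PointedIso A B → toFun A = toFun B

/-- The equivalence relation `ρ(C)`: the pairs of pointed graphs on which all classifiers in `C`
agree. -/
def rho {P : Type*} (C : Set (NodeClassifier P)) : Set (PointedGraph P × PointedGraph P) :=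
  {q | ∀ c ∈ C, c.toFun q.1 = c.toFun q.2}

/-! ## Graph neural networks -/

/-- One layer: an aggregation function `ℳ(ℝ^D) → ℝ^D` and a combination function
`ℝ^(2D) → ℝ^E`, with `E ≥ 1`. Both functions are arbitrary. -/
structure GNNLayer (D E : ℕ) where
  pos : 0 < E
  agg : Multiset (Fin D → ℝ) → (Fin D → ℝ)
  com : (Fin (D + D) → ℝ) → (Fin E → ℝ)

/-- A `(D, D')`-GNN: a nonempty composable list of layers. -/
inductive GNN : ℕ → ℕ → Type
  | single {D D' : ℕ} (l : GNNLayer D D') : GNN D D'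
  | cons {D E D' : ℕ} (l : GNNLayer D E) (rest : GNN E D') : GNN D D'

/-- The multiset of the values of `emb` at the neighbours of `v`. -/
def nbrMultiset {P X : Type*} (G : LabeledGraph P) (emb : G.V → X) (v : G.V) : Multiset X :=
  open Classical in (Finset.univ.filter fun u => G.graph.Adj v u).val.map emb

/-- The effect of one layer on an embedding. -/
def GNNLayer.run {P : Type*} {D E : ℕ} (l : GNNLayer D E) (G : LabeledGraph P)
    (emb : G.V → Fin D → ℝ) : G.V → Fin E → ℝ :=
  fun v => l.com (Fin.append (emb v) (l.agg (nbrMultiset G emb v)))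

/-- The function on embeddings that a GNN computes. -/
def GNN.run {P : Type*} (G : LabeledGraph P) :
    {D D' : ℕ} → GNN D D' → (G.V → Fin D → ℝ) → (G.V → Fin D' → ℝ)
  | _, _, .single l, emb => l.run G emb
  | _, _, .cons l rest, emb => GNN.run G rest (l.run G emb)

/-- The multi-hot encoding of the labels, for a fixed enumeration of `P`. -/
def multiHot {P : Type*} [Fintype P] (G : LabeledGraph P) : G.V → Fin (Fintype.card P) → ℝ :=
  fun v i => open Classical in if (Fintype.equivFin P).symm i ∈ G.lab v then 1 else 0

/-! ## Hierarchical ego GNNs -/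

/-- `HEGNN d D D'` is the type of `(D, D')`-HE-GNNs of nesting depth `d`. -/
inductive HEGNN : ℕ → ℕ → ℕ → Type
  | base {D D' : ℕ} (A : GNN D D') : HEGNN 0 D D'
  | nest {d D D'' D' : ℕ} (B : HEGNN d (D + 1) D'') (C : GNN (D + D'') D') : HEGNN (d + 1) D D'

/-- Extend every node embedding by one coordinate, which is `1` at `v` and `0` elsewhere. -/
def markNode {V : Type*} {D : ℕ} (emb : V → Fin D → ℝ) (v : V) : V → Fin (D + 1) → ℝ :=
  fun u => open Classical in Fin.snoc (α := fun _ => ℝ) (emb u) (if u = v then 1 else 0)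

/-- The function on embeddings that an HE-GNN computes. -/
def HEGNN.run {P : Type*} (G : LabeledGraph P) :
    {d D D' : ℕ} → HEGNN d D D' → (G.V → Fin D → ℝ) → (G.V → Fin D' → ℝ)
  | _, _, _, .base A, emb => A.run G emb
  | _, _, _, .nest B C, emb =>
      C.run G fun v => Fin.append (emb v) (HEGNN.run G B (markNode emb v) v)

/-! ## Higher-order Weisfeiler–Leman -/

/-- Atomic types of `k`-tuples of nodes: which entries are equal, which are adjacent, and the
labels of the entries. -/
abbrev AtomicType (P : Type*) (k : ℕ) : Type _ :=
  (Fin k → Fin k → Prop) × (Fin k → Fin k → Prop) × (Fin k → Set P)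

/-- The atomic type of a tuple, i.e. the isomorphism type of the ordered induced subgraph. -/
def atp {P : Type*} (G : LabeledGraph P) {k : ℕ} (v : Fin k → G.V) : AtomicType P k :=
  (fun i j => v i = v j, fun i j => G.graph.Adj (v i) (v j), fun i => G.lab (v i))

/-- The colours of `k`-WL after `n` rounds. The perfect hash function is the one that keeps its
argument, so that two colours agree exactly when the hashed data agree. -/
def WLColor (P : Type*) (k : ℕ) : ℕ → Type _
  | 0 => AtomicType P k
  | n + 1 => WLColor P k n × Multiset (AtomicType P (k + 1) × (Fin k → WLColor P k n))

/-- The colouring of `k`-tuples after `n` rounds of `k`-WL: a tuple `v` starts with its atomic type;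
in a round it gets its old colour together with the multiset, over all nodes `w`, of the atomic type
of `(v₁, …, v_k, w)` and the old colours of `v[w/1], …, v[w/k]`. -/
def wlColor {P : Type*} (G : LabeledGraph P) (k : ℕ) :
    (n : ℕ) → (Fin k → G.V) → WLColor P k n
  | 0, v => atp G v
  | n + 1, v =>
      (wlColor G k n v, (Finset.univ : Finset G.V).val.map fun w =>
        (atp G (Fin.snoc (α := fun _ => G.V) v w : Fin (k + 1) → G.V),
          fun i => wlColor G k n (Function.update v i w)))

/-! ## Higher-order GNNs -/

/-- One layer of a `k`-GNN: an aggregation function for every position of the tuple and a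
combination function `ℝ^D × (ℝ^D)^k → ℝ^E`, with `E ≥ 1`. -/
structure KGNNLayer (k D E : ℕ) where
  pos : 0 < E
  agg : Fin k → Multiset (Fin D → ℝ) → (Fin D → ℝ)
  com : (Fin D → ℝ) → (Fin k → Fin D → ℝ) → (Fin E → ℝ)

/-- A `k`-GNN with input dimension `D` and output dimension `D'`. -/
inductive KGNN (k : ℕ) : ℕ → ℕ → Type
  | single {D D' : ℕ} (l : KGNNLayer k D D') : KGNN k D D'
  | cons {D E D' : ℕ} (l : KGNNLayer k D E) (rest : KGNN k E D') : KGNN k D D'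

/-- One layer of message passing between `k`-tuples: the neighbours of `v` at position `j` are the
tuples `v[w/j]`. -/
def KGNNLayer.run {P : Type*} {k D E : ℕ} (l : KGNNLayer k D E) (G : LabeledGraph P)
    (emb : (Fin k → G.V) → Fin D → ℝ) : (Fin k → G.V) → Fin E → ℝ :=
  fun v => l.com (emb v) fun j =>
    l.agg j ((Finset.univ : Finset G.V).val.map fun w => emb (Function.update v j w))

/-- The function on embeddings of `k`-tuples that a `k`-GNN computes. -/
def KGNN.run {P : Type*} (G : LabeledGraph P) {k : ℕ} :
    {D D' : ℕ} → KGNN k D D' → ((Fin k → G.V) → Fin D → ℝ) → ((Fin k → G.V) → Fin D' → ℝ)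
  | _, _, .single l, emb => l.run G emb
  | _, _, .cons l rest, emb => KGNN.run G rest (l.run G emb)

/-- The one-hot encoding of the atomic types of the `k`-tuples, for a fixed enumeration of the
finitely many atomic types. -/
def oneHotAtp {P : Type*} [Fintype P] (G : LabeledGraph P) (k : ℕ) :
    (Fin k → G.V) → Fin (Nat.card (AtomicType P k)) → ℝ :=
  fun v => Pi.single (Finite.equivFin (AtomicType P k) (atp G v)) 1

/-! ## Isomorphism invariance -/

section Invariance

variable {P : Type*} {G H : LabeledGraph P} {f : G.V ≃ H.V}

theorem nbrMultiset_iso {X : Type*} (hf : IsGraphIso f) (e : G.V → X) (e' : H.V → X)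
    (he : ∀ u, e' (f u) = e u) (v : G.V) : nbrMultiset H e' (f v) = nbrMultiset G e v := by
  classical
  have h : (Finset.univ.filter fun u => H.graph.Adj (f v) u)
      = (Finset.univ.filter fun u => G.graph.Adj v u).map f.toEmbedding := by
    ext u
    obtain ⟨u, rfl⟩ := f.surjective u
    simp [hf.1]
  unfold nbrMultiset
  convert_to ((Finset.univ.filter fun u => H.graph.Adj (f v) u)).val.map e' = _
  rw [h, Finset.map_val, Multiset.map_map]
  convert_to _ = ((Finset.univ.filter fun u => G.graph.Adj v u)).val.map e
  exact Multiset.map_congr rfl fun u _ => he u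

theorem univMultiset_iso {X : Type*} (f : G.V ≃ H.V) (e : G.V → X) (e' : H.V → X)
    (he : ∀ u, e' (f u) = e u) :
    (Finset.univ : Finset H.V).val.map e' = (Finset.univ : Finset G.V).val.map e := by
  rw [← Finset.map_univ_equiv f, Finset.map_val, Multiset.map_map]
  congr 1
  funext u
  exact he u

theorem GNNLayer.run_iso {D E : ℕ} (l : GNNLayer D E) (hf : IsGraphIso f)
    (e : G.V → Fin D → ℝ) (e' : H.V → Fin D → ℝ) (he : ∀ u, e' (f u) = e u) (v : G.V) :
    l.run H e' (f v) = l.run G e v := by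
  simp only [GNNLayer.run, he, nbrMultiset_iso hf e e' he]

theorem GNN.run_iso {D D' : ℕ} (A : GNN D D') (hf : IsGraphIso f) :
    ∀ (e : G.V → Fin D → ℝ) (e' : H.V → Fin D → ℝ), (∀ u, e' (f u) = e u) →
      ∀ v, A.run H e' (f v) = A.run G e v := by
  induction A with
  | single l => exact fun e e' he v => l.run_iso hf e e' he v
  | cons l rest ih => exact fun e e' he v => ih _ _ (l.run_iso hf e e' he) v

theorem HEGNN.run_iso {d D D' : ℕ} (A : HEGNN d D D') (hf : IsGraphIso f) :
    ∀ (e : G.V → Fin D → ℝ) (e' : H.V → Fin D → ℝ), (∀ u, e' (f u) = e u) →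
      ∀ v, A.run H e' (f v) = A.run G e v := by
  induction A with
  | base A => exact fun e e' he v => A.run_iso hf e e' he v
  | nest B C ih =>
    intro e e' he v
    refine C.run_iso hf _ _ (fun u => ?_) v
    rw [he, ih (markNode e u) (markNode e' (f u)) (fun w => ?_) u]
    unfold markNode
    rw [he]
    refine congrArg (Fin.snoc (α := fun _ => ℝ) (e w)) ?_
    by_cases h : w = u <;> simp [h]

theorem multiHot_iso [Fintype P] (hf : IsGraphIso f) (v : G.V) :
    multiHot H (f v) = multiHot G v := by
  unfold multiHot
  rw [hf.2]

theorem atp_iso (hf : IsGraphIso f) {k : ℕ} (v : Fin k → G.V) :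
    atp H (fun i => f (v i)) = atp G v := by
  simp [atp, hf.1, hf.2]

theorem wlColor_iso (hf : IsGraphIso f) (k n : ℕ) :
    ∀ v : Fin k → G.V, wlColor H k n (fun i => f (v i)) = wlColor G k n v := by
  induction n with
  | zero => exact fun v => atp_iso hf v
  | succ n ih =>
    intro v
    refine Prod.ext (ih v) (univMultiset_iso f _ _ fun w => Prod.ext ?_ (funext fun i => ?_))
    · rw [← atp_iso hf]
      refine congrArg (atp H) (funext fun i => ?_)
      refine Fin.lastCases ?_ (fun i => ?_) i <;> simp
    · refine Eq.trans ?_ (ih _)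
      refine congrArg (wlColor H k n) (funext fun j => ?_)
      simp only [Function.update_apply]
      split <;> rfl

theorem KGNNLayer.run_iso {k D E : ℕ} (l : KGNNLayer k D E) (f : G.V ≃ H.V)
    (e : (Fin k → G.V) → Fin D → ℝ) (e' : (Fin k → H.V) → Fin D → ℝ)
    (he : ∀ v, e' (fun i => f (v i)) = e v) (v : Fin k → G.V) :
    l.run H e' (fun i => f (v i)) = l.run G e v := by
  simp only [KGNNLayer.run, he]
  congr 1
  funext j
  congr 1
  refine univMultiset_iso f _ _ fun w => ?_
  rw [← he]
  congr 1
  funext i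
  simp only [Function.update_apply]
  split <;> rfl

theorem KGNN.run_iso {k D D' : ℕ} (A : KGNN k D D') (f : G.V ≃ H.V) :
    ∀ (e : (Fin k → G.V) → Fin D → ℝ) (e' : (Fin k → H.V) → Fin D → ℝ),
      (∀ v, e' (fun i => f (v i)) = e v) →
      ∀ v, A.run H e' (fun i => f (v i)) = A.run G e v := by
  induction A with
  | single l => exact fun e e' he v => l.run_iso f e e' he v
  | cons l rest ih => exact fun e e' he v => ih _ _ (l.run_iso f e e' he) v

theorem oneHotAtp_iso [Fintype P] (hf : IsGraphIso f) (k : ℕ) (v : Fin k → G.V) :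
    oneHotAtp H k (fun i => f (v i)) = oneHotAtp G k v := by
  simp only [oneHotAtp, atp_iso hf]

end Invariance

/-! ## The classes of node classifiers -/

/-- The node classifier of an HE-GNN with input dimension `|P|` and output dimension `1`. -/
def HEGNN.cls {P : Type*} [Fintype P] {d : ℕ} (A : HEGNN d (Fintype.card P) 1) :
    NodeClassifier P where
  toFun X := open Classical in
    decide (0 < A.run X.toLabeledGraph (multiHot X.toLabeledGraph) X.pt 0)
  invariant := by
    rintro X Y ⟨f, hf, hpt⟩
    rw [← hpt, A.run_iso hf _ _ (multiHot_iso hf)]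

/-- All classifiers given by HE-GNNs of nesting depth `d`. -/
def hegnnClassifiers (P : Type*) [Fintype P] (d : ℕ) : Set (NodeClassifier P) :=
  Set.range fun A : HEGNN d (Fintype.card P) 1 => A.cls

/-- The node classifier of `k`-WL given by a number `n` of rounds and a set `S` of colours: the node
`v` is classified by the colour of the tuple `(v, …, v)`. -/
def wlCls (P : Type*) (k n : ℕ) (S : Set (WLColor P k n)) : NodeClassifier P where
  toFun X := open Classical in decide (wlColor X.toLabeledGraph k n (fun _ => X.pt) ∈ S)
  invariant := by
    rintro X Y ⟨f, hf, hpt⟩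
    rw [← hpt, ← wlColor_iso hf k n]

/-- All classifiers given by `k`-WL. -/
def wlClassifiers (P : Type*) (k : ℕ) : Set (NodeClassifier P) :=
  {c | ∃ (n : ℕ) (S : Set (WLColor P k n)), c = wlCls P k n S}

/-- The node classifier of a `k`-GNN with output dimension `1`, run on the one-hot encoding of the
atomic types: the node `v` is classified by the output at the tuple `(v, …, v)`. -/
def KGNN.cls {P : Type*} [Fintype P] {k : ℕ} (A : KGNN k (Nat.card (AtomicType P k)) 1) :
    NodeClassifier P where
  toFun X := open Classical in
    decide (0 < A.run X.toLabeledGraph (oneHotAtp X.toLabeledGraph k) (fun _ => X.pt) 0)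
  invariant := by
    rintro X Y ⟨f, hf, hpt⟩
    rw [← hpt, A.run_iso f _ _ (oneHotAtp_iso hf k)]

/-- All classifiers given by `k`-GNNs. -/
def kgnnClassifiers (P : Type*) [Fintype P] (k : ℕ) : Set (NodeClassifier P) :=
  Set.range fun A : KGNN k (Nat.card (AtomicType P k)) 1 => A.cls

end

/-! ## Preliminaries -/

/-! Both higher-order equivalences are back-and-forth equivalences. Equality of `k`-WL colours in
all rounds is an `IsWLBisim` (`isWLBisim_wlColor`), and every `IsWLBisim` preserves colours. For
`k`-GNNs, a bisimulation preserves all embeddings; conversely, iterating one lossless layer, which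
exists by cardinality (`KGNNLayer.exists_injective`), produces an `IsGNNBisim`.

It remains to translate between systems on `k`-tuples and on `(k+1)`-tuples. From WL to GNN,
replacing entry `j` of a `(k+1)`-tuple amounts to deleting it and extending the remaining `k`-tuple
(`IsWLBisim.isGNNBisim`). From GNN to WL, a `k`-tuple carries a hidden extra entry; replacing that
entry gives one bijection that serves all positions at once (`IsGNNBisim.isWLBisim`).

For HE-GNNs of depth `d`, the `d + 1` positions act as pebbles: one moves along edges during message
passing, and each nesting level freezes one more on the marked node (`AgreeOn.hegnn_run`). -/

theorem exists_equiv_of_map_univ_eq {α β γ : Type*} [Fintype α] [Fintype β] {f : α → γ}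
    {g : β → γ}
    (h : (Finset.univ : Finset α).val.map f = (Finset.univ : Finset β).val.map g) :
    ∃ e : α ≃ β, ∀ x, g (e x) = f x := by
  classical
  have key : ∀ c, Nonempty ({a // f a = c} ≃ {b // g b = c}) := fun c => by
    refine ⟨Fintype.equivOfCardEq ?_⟩
    have := congrArg (Multiset.count c) h
    rw [Multiset.count_map, Multiset.count_map] at this
    rw [Fintype.card_subtype, Fintype.card_subtype]
    simpa [Finset.card_def, Finset.filter_val, eq_comm] using this
  exact ⟨Equiv.ofFiberEquiv fun c => (key c).some, fun x => Equiv.ofFiberEquiv_map _ x⟩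

theorem map_univ_eq_of_equiv {α β γ : Type*} [Fintype α] [Fintype β] {f : α → γ} {g : β → γ}
    (e : α ≃ β) (h : ∀ x, f x = g (e x)) :
    (Finset.univ : Finset α).val.map f = (Finset.univ : Finset β).val.map g := by
  rw [← Finset.map_univ_equiv e, Finset.map_val, Multiset.map_map]
  exact Multiset.map_congr rfl fun x _ => h x

/-- A decreasing sequence of predicates on a finite type becomes stationary. -/
theorem exists_stable_of_antitone {α : Type*} [Finite α] (p : ℕ → α → Prop)
    (hp : ∀ n a, p (n + 1) a → p n a) : ∃ N, ∀ a, p N a → ∀ n, p n a := by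
  classical
  have := Fintype.ofFinite α
  have mono : ∀ {m n}, m ≤ n → ∀ a, p n a → p m a := fun {m n} hmn => by
    induction hmn with
    | refl => exact fun _ h => h
    | step _ ih => exact fun a h => ih a (hp _ a h)
  have hex : ∀ a, ∃ n, p n a → ∀ m, p m a := fun a => by
    by_cases h : ∀ m, p m a
    · exact ⟨0, fun _ => h⟩
    · obtain ⟨n, hn⟩ := not_forall.1 h
      exact ⟨n, fun h' => absurd h' hn⟩
  choose N hN using hex
  exact ⟨Finset.univ.sup N, fun a h => hN a (mono (Finset.le_sup (Finset.mem_univ a)) a h)⟩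

theorem atp_comp {P : Type*} {G H : LabeledGraph P} {k l : ℕ} {v : Fin k → G.V} {w : Fin k → H.V}
    (h : atp G v = atp H w) (g : Fin l → Fin k) : atp G (v ∘ g) = atp H (w ∘ g) := by
  simp only [atp, Prod.mk.injEq, funext_iff] at h ⊢
  exact ⟨fun i j => h.1 _ _, fun i j => h.2.1 _ _, fun i => h.2.2 _⟩

/-! ## Bisimulations -/

section Bisimulations

variable {P : Type*} {G H : LabeledGraph P} {k : ℕ}

/-- A back-and-forth system for `k`-WL. -/
structure IsWLBisim (R : (Fin k → G.V) → (Fin k → H.V) → Prop) : Prop where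
  atp_eq : ∀ {v w}, R v w → atp G v = atp H w
  extend : ∀ {v w}, R v w → ∃ f : G.V ≃ H.V, ∀ x,
    atp G (Fin.snoc (α := fun _ => G.V) v x : Fin (k + 1) → G.V)
        = atp H (Fin.snoc (α := fun _ => H.V) w (f x) : Fin (k + 1) → H.V) ∧
      ∀ j, R (Function.update v j x) (Function.update w j (f x))

/-- A back-and-forth system for `k`-GNNs: in contrast to `IsWLBisim`, the bijection may depend on
the position. -/
structure IsGNNBisim (S : (Fin k → G.V) → (Fin k → H.V) → Prop) : Prop where
  atp_eq : ∀ {v w}, S v w → atp G v = atp H w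
  extend : ∀ {v w}, S v w → ∀ j, ∃ f : G.V ≃ H.V, ∀ x,
    S (Function.update v j x) (Function.update w j (f x))

/-- The closure of a relation between tuples under arbitrary maps of the positions. -/
def compClosure {A B : Type*} (R : (Fin k → A) → (Fin k → B) → Prop) :
    (Fin k → A) → (Fin k → B) → Prop :=
  fun v w => ∃ (v₀ : Fin k → A) (w₀ : Fin k → B) (h : Fin k → Fin k),
    R v₀ w₀ ∧ v = v₀ ∘ h ∧ w = w₀ ∘ h

theorem compClosure_comp {A B : Type*} {R : (Fin k → A) → (Fin k → B) → Prop} {v : Fin k → A}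
    {w : Fin k → B} (hR : compClosure R v w) (h : Fin k → Fin k) :
    compClosure R (v ∘ h) (w ∘ h) := by
  obtain ⟨v₀, w₀, g, h₀, rfl, rfl⟩ := hR
  exact ⟨v₀, w₀, g ∘ h, h₀, rfl, rfl⟩

theorem subset_compClosure {A B : Type*} {R : (Fin k → A) → (Fin k → B) → Prop} {v : Fin k → A}
    {w : Fin k → B} (h : R v w) : compClosure R v w :=
  ⟨v, w, id, h, rfl, rfl⟩

/-- By pigeonhole, the `k - 1` positions other than `j` cannot use up all `k` values. The slot `m`
is free to receive a new node without disturbing the other entries of `v ∘ h`. -/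
theorem exists_forall_ne_apply_ne (h : Fin k → Fin k) (j : Fin k) :
    ∃ m, ∀ l, l ≠ j → h l ≠ m := by
  classical
  have hc : ((Finset.univ.erase j).image h).card < Fintype.card (Fin k) := by
    refine Finset.card_image_le.trans_lt ?_
    rw [← Finset.card_univ]
    exact Finset.card_erase_lt_of_mem (Finset.mem_univ j)
  obtain ⟨m, -, hm⟩ := Finset.exists_mem_notMem_of_card_lt_card (Finset.card_univ (α := Fin k) ▸ hc)
  exact ⟨m, fun l hl e => hm (Finset.mem_image.2 ⟨l, by simpa using hl, e⟩)⟩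

theorem update_comp_eq {A : Type*} {h : Fin k → Fin k} {j m : Fin k} (hm : ∀ l, l ≠ j → h l ≠ m)
    (v : Fin k → A) (x : A) :
    Function.update (v ∘ h) j x = Function.update v m x ∘ Function.update h j m := by
  funext l
  by_cases hl : l = j
  · subst hl; simp
  · simp [hl, hm l hl]

theorem snoc_comp_eq {A : Type*} {l : ℕ} (v : Fin k → A) (h : Fin l → Fin k) (x : A) :
    (Fin.snoc (α := fun _ => A) (v ∘ h) x : Fin (l + 1) → A)
      = (Fin.snoc (α := fun _ => A) v x : Fin (k + 1) → A) ∘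
        (Fin.snoc (α := fun _ => Fin (k + 1)) (Fin.castSucc ∘ h) (Fin.last k) :
          Fin (l + 1) → Fin (k + 1)) := by
  funext i
  refine Fin.lastCases ?_ (fun i => ?_) i <;> simp

/-- Replacing entry `j` of `v ∘ h` is replacing an entry of `v` that `h` needs nowhere else,
followed by a rerouted `h`. So the bijection for `v` also serves `v ∘ h`. -/
theorem IsWLBisim.compClosure {R : (Fin k → G.V) → (Fin k → H.V) → Prop} (hR : IsWLBisim R) :
    IsWLBisim (compClosure R) where
  atp_eq := by
    rintro _ _ ⟨v, w, h, h₀, rfl, rfl⟩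
    exact atp_comp (hR.atp_eq h₀) h
  extend := by
    rintro _ _ ⟨v, w, h, h₀, rfl, rfl⟩
    obtain ⟨f, hf⟩ := hR.extend h₀
    refine ⟨f, fun x => ⟨?_, fun j => ?_⟩⟩
    · rw [snoc_comp_eq v, snoc_comp_eq w]
      exact atp_comp (hf x).1 _
    · obtain ⟨m, hm⟩ := exists_forall_ne_apply_ne h j
      exact ⟨_, _, _, (hf x).2 m, update_comp_eq hm v x, update_comp_eq hm w (f x)⟩

/-- Any `k` entries of a `(k+1)`-tuple `(v, x)` form a rearrangement of some `v[x/i]` or of `v`. -/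
theorem exists_snoc_comp_eq (h : Fin k → Fin (k + 1)) :
    (∃ g : Fin k → Fin k, ∀ {A : Type} (v : Fin k → A) (x : A),
      (Fin.snoc (α := fun _ => A) v x : Fin (k + 1) → A) ∘ h = v ∘ g) ∨
    ∃ (i : Fin k) (g : Fin k → Fin k), ∀ {A : Type} (v : Fin k → A) (x : A),
      (Fin.snoc (α := fun _ => A) v x : Fin (k + 1) → A) ∘ h = Function.update v i x ∘ g := by
  classical
  have hs : ¬ Function.Surjective h := fun hs => by
    simpa using Fintype.card_le_of_surjective h hs
  obtain ⟨m, hm⟩ := not_forall.1 hs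
  replace hm : ∀ l, h l ≠ m := fun l e => hm ⟨l, e⟩
  -- The map `h` misses some position `m`. If `m` is the last one, `x` is not used; otherwise the
  -- slot `m` of `v` is unused and can store `x`.
  induction m using Fin.lastCases with
  | last =>
    refine Or.inl ⟨fun l => (h l).castPred (hm l), fun v x => funext fun l => ?_⟩
    conv_lhs => rw [Function.comp_apply, ← Fin.castSucc_castPred (h l) (hm l), Fin.snoc_castSucc]
    rfl
  | cast i =>
    refine Or.inr ⟨i, fun l => if hl : h l = Fin.last k then i else (h l).castPred hl,
      fun v x => funext fun l => ?_⟩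
    by_cases hl : h l = Fin.last k
    · simp [hl]
    · have hne : (h l).castPred hl ≠ i := fun e => hm l (by rw [← e, Fin.castSucc_castPred])
      conv_lhs => rw [Function.comp_apply, ← Fin.castSucc_castPred (h l) hl, Fin.snoc_castSucc]
      simp [hl, hne]

/-- The map `π` depends on `j` alone, so the same rearrangement applies to the tuples of both
graphs. -/
theorem update_eq_snoc_comp (j : Fin (k + 1)) :
    ∃ π : Fin (k + 1) → Fin (k + 1), ∀ {A : Type} (v : Fin (k + 1) → A) (x : A),
      Function.update v j x
        = (Fin.snoc (α := fun _ => A) (v ∘ j.succAbove) x : Fin (k + 1) → A) ∘ π := by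
  refine ⟨j.insertNth (α := fun _ => Fin (k + 1)) (Fin.last k) Fin.castSucc,
    fun v x => funext fun l => ?_⟩
  induction l using Fin.succAboveCases j with
  | x => simp
  | p l => simp

/-- The bijection comes from the `k`-tuple without entry `j`. The atomic type of the extended tuple
is part of the WL data; any `k` of its entries rearrange either the old `k`-tuple or one with `x`
substituted. The condition on `atp` is needed separately: for `k = 1`, single entries do not see
adjacency. -/
theorem IsWLBisim.isGNNBisim {R : (Fin k → G.V) → (Fin k → H.V) → Prop} (hR : IsWLBisim R)
    (hc : ∀ {v w}, R v w → ∀ h : Fin k → Fin k, R (v ∘ h) (w ∘ h)) :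
    IsGNNBisim fun (v : Fin (k + 1) → G.V) (w : Fin (k + 1) → H.V) =>
      atp G v = atp H w ∧ ∀ h : Fin k → Fin (k + 1), R (v ∘ h) (w ∘ h) where
  atp_eq h := h.1
  extend := by
    rintro v w ⟨-, hvw⟩ j
    obtain ⟨f, hf⟩ := hR.extend (hvw j.succAbove)
    obtain ⟨π, hπ⟩ := update_eq_snoc_comp j
    refine ⟨f, fun x => ?_⟩
    rw [hπ, hπ]
    refine ⟨atp_comp (hf x).1 π, fun h => ?_⟩
    rw [Function.comp_assoc, Function.comp_assoc]
    obtain ⟨g, hg⟩ | ⟨i, g, hg⟩ := exists_snoc_comp_eq (π ∘ h)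
    · rw [hg, hg]
      exact hc (hvw j.succAbove) g
    · rw [hg, hg]
      exact hc ((hf x).2 i) g

/-- Since `(v[x/j], v j)` is `(v, x)` with two entries swapped, a single bijection for the hidden
entry handles every `j`: the displaced node becomes the new hidden entry. The permutation `σ` is
there because `S` need not be invariant under permuting positions. -/
theorem IsGNNBisim.isWLBisim {S : (Fin (k + 1) → G.V) → (Fin (k + 1) → H.V) → Prop}
    (hS : IsGNNBisim S) :
    IsWLBisim fun (v : Fin k → G.V) (w : Fin k → H.V) => ∃ x y, ∃ σ : Equiv.Perm (Fin (k + 1)),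
      S ((Fin.snoc (α := fun _ => G.V) v x : Fin (k + 1) → G.V) ∘ σ)
        ((Fin.snoc (α := fun _ => H.V) w y : Fin (k + 1) → H.V) ∘ σ) where
  atp_eq := by
    rintro v w ⟨x, y, σ, h⟩
    have := atp_comp (hS.atp_eq h) (σ.symm ∘ Fin.castSucc)
    convert this using 2 <;> ext i <;> simp
  extend := by
    rintro v w ⟨x₀, y₀, σ, h⟩
    -- This is the position at which the hidden entry sits after rearrangement by `σ`.
    obtain ⟨f, hf⟩ := hS.extend h (σ.symm (Fin.last k))
    have upd : ∀ {A : Type} (u : Fin k → A) (z z' : A), Function.update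
        ((Fin.snoc (α := fun _ => A) u z : Fin (k + 1) → A) ∘ σ) (σ.symm (Fin.last k)) z'
          = (Fin.snoc (α := fun _ => A) u z' : Fin (k + 1) → A) ∘ σ := fun {A} u z z' => by
      rw [← Function.update_comp_equiv, Fin.update_snoc_last]
    simp only [upd] at hf
    refine ⟨f, fun x => ⟨?_, fun j => ⟨v j, w j, σ.trans (Equiv.swap j.castSucc (Fin.last k)), ?_⟩⟩⟩
    · convert atp_comp (hS.atp_eq (hf x)) σ.symm using 2 <;> ext i <;> simp
    · have sw : ∀ {A : Type} (u : Fin k → A) (z : A),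
          (Fin.snoc (α := fun _ => A) (Function.update u j z) (u j) : Fin (k + 1) → A) ∘
            Equiv.swap j.castSucc (Fin.last k) = Fin.snoc (α := fun _ => A) u z :=
        fun {A} u z => by
        funext i
        induction i using Fin.lastCases with
        | last => simp
        | cast i =>
          by_cases hi : i = j
          · subst hi; simp [Function.update_of_ne (Fin.castSucc_lt_last i).ne']
          · rw [Function.comp_apply, Equiv.swap_apply_of_ne_of_ne
              (by simpa using hi) (Fin.castSucc_lt_last i).ne]
            simp [hi]
      have := hf x
      rw [← sw v x, ← sw w (f x)] at this
      exact this

/-! ## Weisfeiler–Leman colourings and bisimulations -/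

theorem IsWLBisim.wlColor_eq {R : (Fin k → G.V) → (Fin k → H.V) → Prop} (hR : IsWLBisim R)
    (n : ℕ) : ∀ {v w}, R v w → wlColor G k n v = wlColor H k n w := by
  induction n with
  | zero => exact fun h => hR.atp_eq h
  | succ n ih =>
    intro v w h
    obtain ⟨f, hf⟩ := hR.extend h
    exact Prod.ext (ih h) (map_univ_eq_of_equiv f fun x =>
      Prod.ext (hf x).1 (funext fun j => ih ((hf x).2 j)))

/-- There are finitely many pairs of tuples, so some round `N` already separates every pair that is
ever separated. The bijection is read off from round `N + 1`, whose multisets contain the colours of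
round `N`. -/
theorem isWLBisim_wlColor :
    IsWLBisim fun (v : Fin k → G.V) (w : Fin k → H.V) =>
      ∀ n, wlColor G k n v = wlColor H k n w where
  atp_eq h := h 0
  extend := by
    intro v w h
    obtain ⟨N, hN⟩ := exists_stable_of_antitone
      (fun n (q : (Fin k → G.V) × (Fin k → H.V)) => wlColor G k n q.1 = wlColor H k n q.2)
      fun n q hq => congrArg Prod.fst hq
    obtain ⟨f, hf⟩ := exists_equiv_of_map_univ_eq (congrArg Prod.snd (h (N + 1)))
    refine ⟨f, fun x => ⟨(congrArg Prod.fst (hf x)).symm, fun j => hN (_, _) ?_⟩⟩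
    exact (congrFun (congrArg Prod.snd (hf x)) j).symm

theorem mem_rho_wlClassifiers {A B : PointedGraph P} :
    (A, B) ∈ rho (wlClassifiers P k) ↔
      ∀ n, wlColor A.toLabeledGraph k n (fun _ => A.pt)
        = wlColor B.toLabeledGraph k n (fun _ => B.pt) := by
  constructor
  · intro h n
    -- A singleton set of colours tests for equality with the colour of `A`.
    have := h _ ⟨n, {wlColor A.toLabeledGraph k n (fun _ => A.pt)}, rfl⟩
    simpa [wlCls, eq_comm] using this
  · rintro h _ ⟨n, S, rfl⟩
    simp [wlCls, h n]

/-! ## Higher-order GNNs and bisimulations -/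

theorem KGNNLayer.run_eq_of_bisim {D E : ℕ} (l : KGNNLayer k D E)
    {S : (Fin k → G.V) → (Fin k → H.V) → Prop} (hS : IsGNNBisim S)
    {e : (Fin k → G.V) → Fin D → ℝ} {e' : (Fin k → H.V) → Fin D → ℝ}
    (he : ∀ {v w}, S v w → e v = e' w) {v : Fin k → G.V} {w : Fin k → H.V} (h : S v w) :
    l.run G e v = l.run H e' w := by
  unfold KGNNLayer.run
  rw [he h]
  congr 1
  funext j
  obtain ⟨f, hf⟩ := hS.extend h j
  exact congrArg (l.agg j) (map_univ_eq_of_equiv f fun x => he (hf x))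

theorem KGNN.run_eq_of_bisim {D D' : ℕ} (A : KGNN k D D')
    {S : (Fin k → G.V) → (Fin k → H.V) → Prop} (hS : IsGNNBisim S) :
    ∀ {e : (Fin k → G.V) → Fin D → ℝ} {e' : (Fin k → H.V) → Fin D → ℝ},
      (∀ {v w}, S v w → e v = e' w) → ∀ {v w}, S v w → A.run G e v = A.run H e' w := by
  induction A with
  | single l => exact fun he _ _ h => l.run_eq_of_bisim hS he h
  | cons l rest ih => exact fun he _ _ h => ih (fun h => l.run_eq_of_bisim hS he h) h

/-- The `k`-GNN that applies the layer `l` a number of times, followed by a last layer. -/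
def KGNN.iter {D D' : ℕ} (l : KGNNLayer k D D) (last : KGNNLayer k D D') : ℕ → KGNN k D D'
  | 0 => .single last
  | n + 1 => .cons l (KGNN.iter l last n)

theorem KGNN.iter_run {D D' : ℕ} (l : KGNNLayer k D D) (last : KGNNLayer k D D') (n : ℕ) :
    ∀ e : (Fin k → G.V) → Fin D → ℝ,
      (KGNN.iter l last n).run G e = last.run G ((l.run G)^[n] e) := by
  induction n with
  | zero => exact fun _ => rfl
  | succ n ih => exact fun e => ih _

open Cardinal in
/-- There is a layer without any loss of information, since `ℳ(ℝ^D)` has the cardinality of the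
continuum. -/
theorem KGNNLayer.exists_injective {D : ℕ} (hD : 0 < D) :
    ∃ l : KGNNLayer k D D, (∀ j, Function.Injective (l.agg j)) ∧
      ∀ x y x' y', l.com x y = l.com x' y' → x = x' ∧ y = y' := by
  have : Nonempty (Fin D) := ⟨⟨0, hD⟩⟩
  have hc : #(Fin D → ℝ) = 𝔠 := by
    rw [← Cardinal.power_def, Cardinal.mk_real, Cardinal.mk_fin]
    exact Cardinal.power_nat_eq Cardinal.aleph0_le_continuum hD
  obtain ⟨a⟩ : Nonempty (Multiset (Fin D → ℝ) ↪ (Fin D → ℝ)) := by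
    rw [← Cardinal.le_def, Cardinal.mk_multiset_of_infinite]
  obtain ⟨c⟩ : Nonempty ((Fin D → ℝ) × (Fin k → Fin D → ℝ) ↪ (Fin D → ℝ)) := by
    rw [← Cardinal.le_def, Cardinal.mk_prod, Cardinal.lift_id, Cardinal.lift_id,
      ← Cardinal.power_def (Fin D → ℝ) (Fin k), hc, Cardinal.mk_fin]
    exact Cardinal.mul_le_of_le Cardinal.aleph0_le_continuum le_rfl
      (Cardinal.power_nat_le Cardinal.aleph0_le_continuum)
  refine ⟨⟨hD, fun _ => a, fun x y => c (x, y)⟩, fun _ => a.injective, fun x y x' y' h => ?_⟩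
  exact Prod.ext_iff.1 (c.injective h)

/-- With injective aggregation and combination, equal outputs force equal inputs and equal multisets
at each position, so iteration refines like a colouring and stabilises on finite graphs. -/
theorem isGNNBisim_iterate {D : ℕ} {l : KGNNLayer k D D}
    (hagg : ∀ j, Function.Injective (l.agg j))
    (hcom : ∀ x y x' y', l.com x y = l.com x' y' → x = x' ∧ y = y')
    {e : (Fin k → G.V) → Fin D → ℝ} {e' : (Fin k → H.V) → Fin D → ℝ}
    (he : ∀ v w, e v = e' w → atp G v = atp H w) :
    IsGNNBisim fun (v : Fin k → G.V) (w : Fin k → H.V) =>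
      ∀ n, (l.run G)^[n] e v = (l.run H)^[n] e' w where
  atp_eq h := he _ _ (h 0)
  extend := by
    intro v w h j
    have step : ∀ n v w, (l.run G)^[n + 1] e v = (l.run H)^[n + 1] e' w →
        (l.run G)^[n] e v = (l.run H)^[n] e' w ∧ ∀ j,
          ((Finset.univ : Finset G.V).val.map fun x => (l.run G)^[n] e (Function.update v j x))
            = (Finset.univ : Finset H.V).val.map
                fun x => (l.run H)^[n] e' (Function.update w j x) := by
      intro n v w h
      rw [Function.iterate_succ_apply', Function.iterate_succ_apply'] at h
      obtain ⟨h₁, h₂⟩ := hcom _ _ _ _ h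
      exact ⟨h₁, fun j => hagg j (congrFun h₂ j)⟩
    obtain ⟨N, hN⟩ := exists_stable_of_antitone
      (fun n (q : (Fin k → G.V) × (Fin k → H.V)) => (l.run G)^[n] e q.1 = (l.run H)^[n] e' q.2)
      fun n q hq => (step n _ _ hq).1
    obtain ⟨f, hf⟩ := exists_equiv_of_map_univ_eq ((step N v w (h (N + 1))).2 j)
    exact ⟨f, fun x => hN (_, _) (hf x).symm⟩

theorem mem_rho_kgnnClassifiers [Fintype P] {A B : PointedGraph P} :
    (A, B) ∈ rho (kgnnClassifiers P k) ↔
      ∃ S : (Fin k → A.V) → (Fin k → B.V) → Prop,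
        IsGNNBisim (G := A.toLabeledGraph) (H := B.toLabeledGraph) S ∧
          S (fun _ => A.pt) fun _ => B.pt := by
  constructor
  · intro h
    have hD : 0 < Nat.card (AtomicType P k) := Nat.card_pos
    obtain ⟨l, hagg, hcom⟩ := KGNNLayer.exists_injective (k := k) hD
    refine ⟨_, isGNNBisim_iterate hagg hcom (e := oneHotAtp A.toLabeledGraph k)
      (e' := oneHotAtp B.toLabeledGraph k) fun v w hvw => ?_, fun n => ?_⟩
    · by_contra hne
      have := congrFun hvw (Finite.equivFin _ (atp A.toLabeledGraph v))
      simp [oneHotAtp, hne] at this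
    · classical
      set c := (l.run A.toLabeledGraph)^[n] (oneHotAtp A.toLabeledGraph k) fun _ => A.pt with hc
      -- The threshold sees only the sign of one real, so the last layer tests for equality with the
      -- embedding reached at `A`.
      let last : KGNNLayer k (Nat.card (AtomicType P k)) 1 :=
        ⟨one_pos, fun _ _ => 0, fun x _ _ => if x = c then 1 else 0⟩
      have := h _ ⟨KGNN.iter l last n, rfl⟩
      simp only [KGNN.cls, KGNN.iter_run, last, KGNNLayer.run, ← hc] at this
      by_contra hne
      simp [Ne.symm hne] at this
  · rintro ⟨S, hS, h⟩ _ ⟨C, rfl⟩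
    have := C.run_eq_of_bisim hS (e := oneHotAtp A.toLabeledGraph k)
      (e' := oneHotAtp B.toLabeledGraph k)
      (fun h => by simp only [oneHotAtp, hS.atp_eq h]) h
    simp only [KGNN.cls, this]

theorem rho_wlClassifiers_succ_eq [Fintype P] (d : ℕ) :
    rho (wlClassifiers P (d + 1)) = rho (kgnnClassifiers P (d + 2)) := by
  ext ⟨A, B⟩
  rw [mem_rho_kgnnClassifiers, mem_rho_wlClassifiers]
  constructor
  · intro h
    have hR := (isWLBisim_wlColor (G := A.toLabeledGraph) (H := B.toLabeledGraph)
      (k := d + 1)).compClosure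
    refine ⟨_, hR.isGNNBisim compClosure_comp, ?_, fun g => subset_compClosure h⟩
    exact atp_comp (h 0) fun _ : Fin (d + 2) => 0
  · rintro ⟨S, hS, h⟩ n
    -- The distinguished node serves as hidden entry, which makes the extended tuple constant.
    refine hS.isWLBisim.wlColor_eq n ⟨A.pt, B.pt, 1, ?_⟩
    convert h using 1 <;> funext i <;>
      exact Fin.lastCases (by simp) (fun i => by simp) i

/-! ## Hierarchical ego GNNs -/

/-- Embeddings of two graphs agree along the related pairs of tuples that keep the entries of `a`
and `b` outside the set `X` of positions. -/
def AgreeOn {Y : Type*} (R : (Fin k → G.V) → (Fin k → H.V) → Prop) (X : Finset (Fin k))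
    (a : Fin k → G.V) (b : Fin k → H.V) (e : G.V → Y) (e' : H.V → Y) : Prop :=
  ∀ v w, R v w → (∀ i ∉ X, v i = a i) → (∀ i ∉ X, w i = b i) → ∀ i ∈ X, e (v i) = e' (w i)

section AgreeOn

variable {R : (Fin k → G.V) → (Fin k → H.V) → Prop} {X : Finset (Fin k)}
  {a : Fin k → G.V} {b : Fin k → H.V}

theorem nbrMultiset_eq_of_equiv {Y : Type*} {e : G.V → Y} {e' : H.V → Y} {u : G.V} {u' : H.V}
    (f : G.V ≃ H.V) (hadj : ∀ x, G.graph.Adj u x ↔ H.graph.Adj u' (f x))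
    (he : ∀ x, e x = e' (f x)) : nbrMultiset G e u = nbrMultiset H e' u' := by
  classical
  have h : (Finset.univ.filter fun y => H.graph.Adj u' y)
      = (Finset.univ.filter fun x => G.graph.Adj u x).map f.toEmbedding := by
    ext y
    obtain ⟨x, rfl⟩ := f.surjective y
    simp [hadj]
  unfold nbrMultiset
  convert_to _ = ((Finset.univ.filter fun y => H.graph.Adj u' y)).val.map e'
  rw [h, Finset.map_val, Multiset.map_map]
  convert_to ((Finset.univ.filter fun y => G.graph.Adj u y)).val.map e = _
  exact Multiset.map_congr rfl fun x _ => he x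

/-- The pebble `i` stands on the current node. The extension bijection preserves adjacency to it, by
the atomic type of `(v, x)`, and moving pebble `i` to `x` leaves the frozen positions alone because
`i ∈ X`. -/
theorem AgreeOn.layer_run (hR : IsWLBisim R) {D E : ℕ} (l : GNNLayer D E)
    {e : G.V → Fin D → ℝ} {e' : H.V → Fin D → ℝ} (he : AgreeOn R X a b e e') :
    AgreeOn R X a b (l.run G e) (l.run H e') := by
  intro v w h hv hw i hi
  obtain ⟨f, hf⟩ := hR.extend h
  unfold GNNLayer.run
  rw [he v w h hv hw i hi, nbrMultiset_eq_of_equiv f (fun x => ?_) fun x => ?_]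
  · have := congrFun (congrFun (congrArg (fun t => t.2.1) (hf x).1) i.castSucc) (Fin.last k)
    simpa [atp] using this
  · have := he _ _ ((hf x).2 i)
      (fun j hj => by rw [Function.update_of_ne (ne_of_mem_of_not_mem hi hj).symm, hv j hj])
      (fun j hj => by rw [Function.update_of_ne (ne_of_mem_of_not_mem hi hj).symm, hw j hj]) i hi
    simpa using this

theorem AgreeOn.gnn_run (hR : IsWLBisim R) {D D' : ℕ} (A : GNN D D') :
    ∀ {e : G.V → Fin D → ℝ} {e' : H.V → Fin D → ℝ}, AgreeOn R X a b e e' →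
      AgreeOn R X a b (A.run G e) (A.run H e') := by
  induction A with
  | single l => exact fun he => he.layer_run hR l
  | cons l rest ih => exact fun he => ih (he.layer_run hR l)

/-- Each nesting level removes one position from `X`: pebble `i` stays on the marked node, and a
pebble `j`, first placed on that same node, continues as the moving one. The mark at `u m` depends
only on whether `u m = u i`, which atomic types record. The bound `d + 1` leaves one movable pebble
at depth `0`. -/
theorem AgreeOn.hegnn_run (hR : IsWLBisim R)
    (hc : ∀ {v w}, R v w → ∀ h : Fin k → Fin k, R (v ∘ h) (w ∘ h))
    {d D D' : ℕ} (A : HEGNN d D D') :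
    ∀ {X : Finset (Fin k)} {a : Fin k → G.V} {b : Fin k → H.V} {e : G.V → Fin D → ℝ}
      {e' : H.V → Fin D → ℝ}, d + 1 ≤ X.card → AgreeOn R X a b e e' →
      AgreeOn R X a b (A.run G e) (A.run H e') := by
  induction A with
  | base A => exact fun _ he => he.gnn_run hR A
  | @nest d D D'' D' B C ih =>
    intro X a b e e' hX he
    refine AgreeOn.gnn_run hR C fun v w h hv hw i hi => ?_
    obtain ⟨j, hj, hji⟩ := Finset.exists_mem_ne (by omega : 1 < X.card) i
    have hX' : d + 1 ≤ (X.erase i).card := by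
      rw [Finset.card_erase_of_mem hi]; omega
    -- the tuples that carry the marked node at the positions `i` and `j`
    have h' := hc h (Function.update id j i)
    have hmark : AgreeOn R (X.erase i) (v ∘ Function.update id j i) (w ∘ Function.update id j i)
        (markNode e (v i)) (markNode e' (w i)) := by
      intro u u' hu hua hub m hm
      have hmX := Finset.mem_of_mem_erase hm
      have hui : u i = v i := by simpa [Function.update_of_ne hji.symm] using hua i (by simp)
      have hui' : u' i = w i := by simpa [Function.update_of_ne hji.symm] using hub i (by simp)
      -- Copying node `i` to position `j` changes nothing outside `X`, so the earlier frozen entries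
      -- survive.
      have hou : ∀ n ∉ X, u n = a n ∧ u' n = b n := fun n hn => by
        have hnj : n ≠ j := fun e => hn (e ▸ hj)
        have h₁ := hua n fun h => hn (Finset.mem_of_mem_erase h)
        have h₂ := hub n fun h => hn (Finset.mem_of_mem_erase h)
        simp only [Function.comp_apply, Function.update_of_ne hnj, id] at h₁ h₂
        exact ⟨h₁.trans (hv n hn), h₂.trans (hw n hn)⟩
      have hem := he u u' hu (fun n hn => (hou n hn).1) (fun n hn => (hou n hn).2) m hmX
      have heq := congrFun (congrFun (congrArg Prod.fst (hR.atp_eq hu)) m) i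
      simp only [atp, hui, hui'] at heq
      unfold markNode
      rw [hem]
      congr 1
      by_cases hum : u m = v i
      · simp [hum, heq.mp hum]
      · have hum' : ¬ u' m = w i := fun h => hum (heq.mpr h)
        simp [hum, hum']
    have := ih hX' hmark _ _ h' (fun _ _ => rfl) (fun _ _ => rfl) j (by simp [hj, hji])
    simp only [Function.comp_apply, Function.update_self] at this
    simp only [he v w h hv hw i hi, this]

end AgreeOn

theorem rho_wlClassifiers_subset_rho_hegnnClassifiers [Fintype P] (d : ℕ) :
    rho (wlClassifiers P (d + 1)) ⊆ rho (hegnnClassifiers P d) := by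
  rintro ⟨A, B⟩ hAB
  rw [mem_rho_wlClassifiers] at hAB
  rintro _ ⟨C, rfl⟩
  have hR := (isWLBisim_wlColor (G := A.toLabeledGraph) (H := B.toLabeledGraph)
    (k := d + 1)).compClosure
  -- At the outermost level all `d + 1` positions are movable, so the values of `a` and `b` play no
  -- role.
  have hrun := AgreeOn.hegnn_run hR compClosure_comp C (X := Finset.univ)
    (a := fun _ => A.pt) (b := fun _ => B.pt) (e := multiHot A.toLabeledGraph)
    (e' := multiHot B.toLabeledGraph) (by simp)
    (fun v w h _ _ i _ => by
      have := congrFun (congrArg (fun t => t.2.2) (hR.atp_eq h)) i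
      simp only [atp] at this
      unfold multiHot
      rw [this])
    _ _ (subset_compClosure hAB) (by simp) (by simp) 0 (Finset.mem_univ _)
  simp only [HEGNN.cls, hrun]

end Bisimulations

theorem mainTheorem5 {P : Type*} [Fintype P] (d : ℕ) :
    rho (wlClassifiers P (d + 1)) = rho (kgnnClassifiers P (d + 2)) ∧
      rho (kgnnClassifiers P (d + 2)) ⊆ rho (hegnnClassifiers P d) :=
  ⟨rho_wlClassifiers_succ_eq d, rho_wlClassifiers_succ_eq (P := P) d ▸
    rho_wlClassifiers_subset_rho_hegnnClassifiers d⟩
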